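/- Let $\mathbb{D}=\{z\in\mathbb{C}:|z|<1\}$ and let $\mathcal{S}^*$ be the class of starlike functions: functions $\phi$ analytic and injective in $\mathbb{D}$ with $\phi(0)=0$ and $\phi'(0)=1$, such that $\phi(\mathbb{D})$ is starlike with respect to the origin. Let $\phi(z)=z+\sum_{n\ge 2}\phi_n z^n$ $(z\in\mathbb{D})$ belong to $\mathcal{S}^*$ and let $\alpha\in(1,2]$. Then $$A(\phi_3,\phi_2,\alpha):=-\frac{1}{2(\alpha+1)}\left[\phi_3-\frac{\alpha+1}{4}\phi_2^2+(\alpha+1)\phi_2\right]\in\overline{h(\mathbb{D})},$$ where $h(z)=z+\dfrac{\alpha-2}{2(\alpha+1)}z^2$ and $\overline{h(\mathbb{D})}$ denotes the closure of $h(\mathbb{D})$ in $\mathbb{C}$. -/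

import Mathlib

/-- The class `𝒜` of functions analytic in the open unit disk, normalized by
`f 0 = 0` and `f' 0 = 1`. -/
def classA : Set (ℂ → ℂ) :=
  {f | AnalyticOnNhd ℂ f (Metric.ball (0 : ℂ) 1) ∧ f 0 = 0 ∧ deriv f 0 = 1}

/-- The class `𝒮` of univalent functions in `𝒜`. -/
def classS : Set (ℂ → ℂ) :=
  {f | f ∈ classA ∧ Set.InjOn f (Metric.ball (0 : ℂ) 1)}

/-- The class `𝒮*` of starlike functions: functions in `𝒮` that map the unit disk onto a
domain that is starlike with respect to the origin. -/
def classStarlike : Set (ℂ → ℂ) :=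
  {f | f ∈ classS ∧ StarConvex ℝ (0 : ℂ) (f '' Metric.ball (0 : ℂ) 1)}

/-- The quantity `A(φ₃, φ₂, α)`. -/
noncomputable def coeffA (φ₃ φ₂ : ℂ) (α : ℝ) : ℂ :=
  -(1 / (2 * ((α : ℂ) + 1))) * (φ₃ - ((α : ℂ) + 1) / 4 * φ₂ ^ 2 + ((α : ℂ) + 1) * φ₂)

/-- The polynomial `h(z) = z + (α - 2) / (2 (α + 1)) z²`. -/
noncomputable def hFun (α : ℝ) (z : ℂ) : ℂ :=
  z + ((α : ℂ) - 2) / (2 * ((α : ℂ) + 1)) * z ^ 2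

/-! Put `w = -φ₂/2` and `d = φ₃ - (3/4)φ₂²`. Then `A = h(w) - d/(2(α+1))`, so it is enough to have
`|d| ≤ 1 - |w|²` and to know that `h(𝔻)` contains the disk about `h(w)` of radius `(1 -
|w|²)/(2(α+1))`. The bound on `d` (`norm_four_mul_sub_le_of_starlike`) uses starlikeness through `g
= φ⁻¹(sφ)`, a self-map of `𝔻` fixing `0` for `0 < s < 1`. A second order Schwarz–Pick inequality for
`g(z)/z` has a factor `(1-s)²` on both sides; cancel it and let `s → 1`. The disk
(`mem_closure_image_hFun`) comes from a lower bound for `|h(u) - h(w)|` on `|u| = 1`, where `α ≥ 1`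
is used. -/

open Metric Set Filter Topology

/-! ### Schwarz–Pick at the origin -/

/-- The **Schwarz–Pick inequality** at the origin. -/
theorem norm_deriv_zero_le_one_sub_sq {f : ℂ → ℂ} (hd : DifferentiableOn ℂ f (ball 0 1))
    (hm : MapsTo f (ball 0 1) (closedBall 0 1)) : ‖deriv f 0‖ ≤ 1 - ‖f 0‖ ^ 2 := by
  have h0 : (0 : ℂ) ∈ ball (0 : ℂ) 1 := by simp
  have hle : ∀ z ∈ ball (0 : ℂ) 1, ‖f z‖ ≤ 1 := fun z hz => by simpa using hm hz
  -- Scaling by `t < 1` keeps values strictly inside the disk, so the Möbius denominator never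
  -- vanishes, even for unimodular constants; `t → 1` at the end.
  have key : ∀ t ∈ Ioo (0 : ℝ) 1, t * ‖deriv f 0‖ ≤ 1 - t ^ 2 * ‖f 0‖ ^ 2 := by
    intro t ht
    set a : ℂ := t * f 0 with ha
    have hlt : ∀ z ∈ ball (0 : ℂ) 1, ‖(t : ℂ) * f z‖ < 1 := fun z hz => by
      rw [norm_mul, Complex.norm_of_nonneg ht.1.le]
      nlinarith [hle z hz, ht.1, ht.2, norm_nonneg (f z)]
    have ha1 : ‖a‖ < 1 := hlt 0 h0
    have hne : ∀ z ∈ ball (0 : ℂ) 1, 1 - (starRingEnd ℂ) a * (t * f z) ≠ 0 := by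
      intro z hz h
      have h1 : ‖(starRingEnd ℂ) a * (t * f z)‖ < 1 := by
        rw [norm_mul, RCLike.norm_conj]
        nlinarith [hlt z hz, norm_nonneg a, norm_nonneg ((t : ℂ) * f z)]
      rw [← sub_eq_zero.1 h] at h1
      simp at h1
    set T : ℂ → ℂ := fun z => (t * f z - a) / (1 - (starRingEnd ℂ) a * (t * f z)) with hT
    have hTd : DifferentiableOn ℂ T (ball 0 1) :=
      ((hd.const_mul _).sub_const _).div ((differentiableOn_const _).sub
        ((hd.const_mul _).const_mul _)) hne
    have hT0 : T 0 = 0 := by simp [hT, ha]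
    have hTm : MapsTo T (ball 0 1) (closedBall (T 0) 1) := by
      intro z hz
      rw [hT0, mem_closedBall_zero_iff, hT]
      simp only [norm_div]
      rw [div_le_one (norm_pos_iff.2 (hne z hz)), ← sq_le_sq₀ (norm_nonneg _) (norm_nonneg _)]
      have h1 : ‖a‖ ^ 2 < 1 := by nlinarith [norm_nonneg a]
      have h2 : ‖(t : ℂ) * f z‖ ^ 2 < 1 := by nlinarith [norm_nonneg ((t : ℂ) * f z), hlt z hz]
      generalize (t : ℂ) * f z = w at h2 ⊢
      rw [← Complex.normSq_eq_norm_sq, Complex.normSq_apply] at h1 h2 ⊢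
      rw [← Complex.normSq_eq_norm_sq, Complex.normSq_apply]
      simp only [Complex.sub_re, Complex.sub_im, Complex.mul_re, Complex.mul_im, Complex.one_re,
        Complex.one_im, Complex.conj_re, Complex.conj_im]
      -- `|1 - āw|² - |w - a|² = (1 - |a|²)(1 - |w|²)`.
      nlinarith [mul_pos (sub_pos.2 h1) (sub_pos.2 h2)]
    have hS := Complex.norm_deriv_le_one_of_mapsTo_ball hTd hTm one_pos
    have hf' : HasDerivAt f (deriv f 0) 0 :=
      (hd.differentiableAt (isOpen_ball.mem_nhds h0)).hasDerivAt
    have hT' := ((hf'.const_mul (t : ℂ)).sub_const a).div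
      (((hf'.const_mul (t : ℂ)).const_mul ((starRingEnd ℂ) a)).const_sub 1) (hne 0 h0)
    have hconj : (starRingEnd ℂ) a * a = ((‖a‖ ^ 2 : ℝ) : ℂ) := by
      rw [mul_comm, Complex.mul_conj, Complex.normSq_eq_norm_sq]
    have hpos : 0 < 1 - ‖a‖ ^ 2 := by nlinarith [norm_nonneg a]
    have hval : deriv T 0 = t * deriv f 0 / ((1 - ‖a‖ ^ 2 : ℝ) : ℂ) := by
      have hn : (1 : ℂ) - ((‖a‖ ^ 2 : ℝ) : ℂ) ≠ 0 := by exact_mod_cast hpos.ne'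
      refine hT'.deriv.trans ?_
      rw [← ha, hconj, sub_self, zero_mul, sub_zero, Complex.ofReal_sub, Complex.ofReal_one]
      field_simp
    rw [hval, norm_div, norm_mul, Complex.norm_of_nonneg ht.1.le, Complex.norm_of_nonneg hpos.le,
      div_le_one hpos, ha, norm_mul, Complex.norm_of_nonneg ht.1.le, mul_pow] at hS
    exact hS
  have hl : Tendsto (fun t : ℝ => t * ‖deriv f 0‖) (𝓝[<] 1) (𝓝 (1 * ‖deriv f 0‖)) :=
    ((continuous_id.mul continuous_const).tendsto 1).mono_left nhdsWithin_le_nhds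
  have hr : Tendsto (fun t : ℝ => 1 - t ^ 2 * ‖f 0‖ ^ 2) (𝓝[<] 1)
      (𝓝 (1 - 1 ^ 2 * ‖f 0‖ ^ 2)) :=
    (Continuous.tendsto (by fun_prop) 1).mono_left nhdsWithin_le_nhds
  have := le_of_tendsto_of_tendsto hl hr
    (by filter_upwards [Ioo_mem_nhdsLT (zero_lt_one' ℝ)] with t ht using key t ht)
  simpa using this

/-! ### Inverses of injective analytic functions -/

/-- An injective analytic function maps neighbourhoods to neighbourhoods. -/
theorem image_mem_nhds_of_analyticAt_of_injOn {f : ℂ → ℂ} {U : Set ℂ} {z : ℂ}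
    (hf : AnalyticAt ℂ f z) (hU : U ∈ 𝓝 z) (hi : InjOn f U) {W : Set ℂ} (hW : W ∈ 𝓝 z) :
    f '' W ∈ 𝓝 (f z) := by
  refine (hf.eventually_constant_or_nhds_le_map_nhds.resolve_left fun h => ?_) (image_mem_map hW)
  have h2 : ∀ᶠ w in 𝓝[≠] z, w = z := by
    filter_upwards [nhdsWithin_le_nhds h, nhdsWithin_le_nhds hU] with w hw hwU
    exact hi hwU (mem_of_mem_nhds hU) hw
  obtain ⟨w, hw, hne⟩ := (h2.and self_mem_nhdsWithin).exists
  exact hne hw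

/-- The inverse of an injective analytic function is continuous. -/
theorem continuousAt_of_leftInverse_of_analyticAt {f g : ℂ → ℂ} {U : Set ℂ} {z : ℂ}
    (hU : U ∈ 𝓝 z) (hf : AnalyticAt ℂ f z) (hg : ∀ w ∈ U, g (f w) = w) :
    ContinuousAt g (f z) := by
  have hi : InjOn f U := fun x hx y hy h => by rw [← hg x hx, h, hg y hy]
  intro W hW
  rw [hg z (mem_of_mem_nhds hU)] at hW
  rw [mem_map]
  filter_upwards [image_mem_nhds_of_analyticAt_of_injOn hf hU hi (inter_mem hW hU)]
  rintro _ ⟨w, ⟨hw, hwU⟩, rfl⟩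
  simpa [hg w hwU] using hw

/-- The inverse of an injective analytic function is complex differentiable. -/
theorem differentiableAt_of_leftInverse_of_analyticOnNhd {f g : ℂ → ℂ} {U : Set ℂ}
    (hU : IsOpen U) (hf : AnalyticOnNhd ℂ f U) (hg : ∀ w ∈ U, g (f w) = w) {z : ℂ} (hz : z ∈ U) :
    DifferentiableAt ℂ g (f z) := by
  have hi : InjOn f U := fun x hx y hy h => by rw [← hg x hx, h, hg y hy]
  have hcont : ∀ w ∈ U, ContinuousAt g (f w) := fun w hw =>
    continuousAt_of_leftInverse_of_analyticAt (hU.mem_nhds hw) (hf w hw) hg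
  have himg : ∀ w ∈ U, f '' U ∈ 𝓝 (f w) := fun w hw =>
    image_mem_nhds_of_analyticAt_of_injOn (hf w hw) (hU.mem_nhds hw) hi (hU.mem_nhds hw)
  -- Nonvanishing of `f'` at `z` itself is not needed: its zeros are isolated, so `g` is
  -- differentiable on a punctured neighbourhood of `f z`, and continuity there removes the
  -- singularity.
  have hderiv : ∀ᶠ w in 𝓝[≠] z, deriv f w ≠ 0 := by
    refine (hf z hz).deriv.eventually_eq_zero_or_eventually_ne_zero.resolve_left fun h => ?_
    obtain ⟨r, hr, hball⟩ := Metric.mem_nhds_iff.1 (inter_mem h (hU.mem_nhds hz))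
    have hconst : ∀ w ∈ ball z r, f w = f z := fun w hw =>
      isOpen_ball.is_const_of_deriv_eq_zero (convex_ball z r).isPreconnected
        (fun x hx => (hf x (hball hx).2).differentiableAt.differentiableWithinAt)
        (fun x hx => (hball hx).1) hw (mem_ball_self hr)
    have hev : ∀ᶠ w in 𝓝[≠] z, w ∈ ball z r := nhdsWithin_le_nhds (ball_mem_nhds z hr)
    obtain ⟨w, hw, hne⟩ := (hev.and self_mem_nhdsWithin).exists
    exact hne (hi (hball hw).2 hz (hconst w hw))
  have hgz : Tendsto g (𝓝[≠] (f z)) (𝓝[≠] z) := by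
    refine tendsto_nhdsWithin_iff.2 ⟨?_, ?_⟩
    · simpa [ContinuousAt, hg z hz] using (hcont z hz).mono_left nhdsWithin_le_nhds
    · filter_upwards [self_mem_nhdsWithin, nhdsWithin_le_nhds (himg z hz)]
      rintro _ hne ⟨w, hw, rfl⟩ h
      rw [mem_singleton_iff, hg w hw] at h
      exact hne (by rw [h]; rfl)
  refine (Complex.analyticAt_of_differentiable_on_punctured_nhds_of_continuousAt ?_
    (hcont z hz)).differentiableAt
  filter_upwards [hgz.eventually hderiv, nhdsWithin_le_nhds (himg z hz)]
  rintro _ hne ⟨w, hw, rfl⟩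
  rw [hg w hw] at hne
  refine (HasDerivAt.of_local_left_inverse (hcont w hw)
    (by rw [hg w hw]; exact (hf w hw).differentiableAt.hasDerivAt) hne ?_).differentiableAt
  filter_upwards [himg w hw]
  rintro _ ⟨v, hv, rfl⟩
  rw [hg v hv]

/-! ### Disks covered by `h(𝔻)` -/

/-- If the image of the unit circle under `F` stays at distance `ρ` from `F w`, then the image of
the unit disk contains the disk of radius `ρ` around `F w`. -/
theorem ball_subset_image_ball_of_le_norm_sub {F : ℂ → ℂ} {w : ℂ} {ρ : ℝ}
    (hF : AnalyticOnNhd ℂ F univ) (hw : w ∈ ball (0 : ℂ) 1) (hρ : 0 < ρ)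
    (hb : ∀ u : ℂ, ‖u‖ = 1 → ρ ≤ ‖F u - F w‖) : ball (F w) ρ ⊆ F '' ball 0 1 := by
  have hcont : Continuous F := continuous_iff_continuousAt.2 fun z => (hF z trivial).continuousAt
  have hopen : IsOpen (F '' ball 0 1) := by
    refine (hF.is_constant_or_isOpen isPreconnected_univ).resolve_left ?_ _ (subset_univ _)
      isOpen_ball
    rintro ⟨v, hv⟩
    have := hb 1 (by simp)
    rw [hv 1 trivial, hv w trivial, sub_self, norm_zero] at this
    linarith
  refine (convex_ball _ _).isPreconnected.subset_of_closure_inter_subset hopen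
    ⟨F w, mem_ball_self hρ, mem_image_of_mem F hw⟩ ?_
  rintro y ⟨hy, hyb⟩
  have hsub : closure (F '' ball 0 1) ⊆ F '' closedBall 0 1 :=
    closure_minimal (image_mono ball_subset_closedBall)
      ((isCompact_closedBall 0 1).image hcont).isClosed
  obtain ⟨u, hu, rfl⟩ := hsub hy
  rw [mem_closedBall_zero_iff] at hu
  rcases hu.lt_or_eq with h | h
  · exact mem_image_of_mem F (mem_ball_zero_iff.2 h)
  · exact absurd (mem_ball_iff_norm.1 hyb) (hb u h).not_gt

theorem mem_closure_image_hFun {α : ℝ} (hα : α ∈ Ioc (1 : ℝ) 2) {w d : ℂ} (hw : ‖w‖ ≤ 1)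
    (hd : ‖d‖ ≤ 1 - ‖w‖ ^ 2) :
    hFun α w - 1 / (2 * ((α : ℂ) + 1)) * d ∈ closure (hFun α '' ball (0 : ℂ) 1) := by
  obtain ⟨hα1, hα2⟩ := hα
  have hcont : Continuous (hFun α) := by unfold hFun; fun_prop
  have hpos : 0 < 2 * (α + 1) := by linarith
  rcases hw.lt_or_eq with h | h
  · have hρ : 0 < 1 / (2 * (α + 1)) * (1 - ‖w‖ ^ 2) :=
      mul_pos (by positivity) (by nlinarith [norm_nonneg w])
    refine closure_mono (ball_subset_image_ball_of_le_norm_sub (w := w) (fun z _ => ?_)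
      (mem_ball_zero_iff.2 h) hρ fun u hu => ?_) ?_
    · unfold hFun
      fun_prop
    · have hfac : hFun α u - hFun α w =
          (u - w) * (1 - ((((2 - α) / (2 * (α + 1)) : ℝ)) : ℂ) * (u + w)) := by
        simp only [hFun]
        push_cast
        ring
      have h1 : 1 - ‖w‖ ≤ ‖u - w‖ := hu ▸ norm_sub_norm_le u w
      have hk0 : 0 ≤ (2 - α) / (2 * (α + 1)) := div_nonneg (by linarith) hpos.le
      have h2 : 1 - (2 - α) / (2 * (α + 1)) * (1 + ‖w‖) ≤
          ‖1 - ((((2 - α) / (2 * (α + 1)) : ℝ)) : ℂ) * (u + w)‖ := by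
        have h3 := norm_sub_norm_le (1 : ℂ) (((((2 - α) / (2 * (α + 1)) : ℝ)) : ℂ) * (u + w))
        rw [norm_one, norm_mul, Complex.norm_of_nonneg hk0] at h3
        have h4 := mul_le_mul_of_nonneg_left (hu ▸ norm_add_le u w) hk0
        linarith
      -- This amounts to `(3 - α)(1 + |w|) ≤ 2(α + 1)`, which holds because `|w| ≤ 1 ≤ α`.
      have h5 : 1 / (2 * (α + 1)) * (1 + ‖w‖) ≤ 1 - (2 - α) / (2 * (α + 1)) * (1 + ‖w‖) := by
        rw [le_sub_iff_add_le, ← add_mul, ← add_div, div_mul_eq_mul_div, div_le_one hpos]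
        nlinarith [norm_nonneg w]
      rw [hfac, norm_mul]
      calc 1 / (2 * (α + 1)) * (1 - ‖w‖ ^ 2)
          = (1 - ‖w‖) * (1 / (2 * (α + 1)) * (1 + ‖w‖)) := by ring
        _ ≤ _ := mul_le_mul h1 (h5.trans h2)
            (mul_nonneg (by positivity) (by positivity)) (norm_nonneg _)
    · rw [closure_ball _ hρ.ne', mem_closedBall_iff_norm, sub_sub_cancel_left, norm_neg, norm_mul]
      have : ‖(1 / (2 * ((α : ℂ) + 1)))‖ = 1 / (2 * (α + 1)) := by
        rw [← Complex.norm_of_nonneg (show 0 ≤ 1 / (2 * (α + 1)) by positivity)]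
        push_cast
        rfl
      rw [this]
      gcongr
  · obtain rfl : d = 0 := by
      rw [h] at hd
      exact norm_le_zero_iff.1 (by linarith)
    rw [mul_zero, sub_zero]
    refine image_closure_subset_closure_image hcont (mem_image_of_mem _ ?_)
    rw [closure_ball _ one_ne_zero]
    simpa using hw

/-! ### Coefficient inequalities -/

theorem eqOn_ball_of_eq_of_ne {f g : ℂ → ℂ} (hf : DifferentiableOn ℂ f (ball 0 1))
    (hg : DifferentiableOn ℂ g (ball 0 1))
    (h : ∀ z ∈ ball (0 : ℂ) 1, z ≠ 0 → f z = g z) : EqOn f g (ball 0 1) := by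
  intro z hz
  rcases eq_or_ne z 0 with rfl | hne
  · have hn : ball (0 : ℂ) 1 ∈ 𝓝 0 := isOpen_ball.mem_nhds hz
    refine tendsto_nhds_unique_of_eventuallyEq
      ((hf.continuousOn.continuousAt hn).tendsto.mono_left (nhdsWithin_le_nhds (s := {0}ᶜ)))
      ((hg.continuousOn.continuousAt hn).tendsto.mono_left nhdsWithin_le_nhds) ?_
    filter_upwards [self_mem_nhdsWithin, nhdsWithin_le_nhds hn] with w hw hwb using h w hwb hw
  · exact h z hz hne

theorem eq_add_mul_dslope_zero (f : ℂ → ℂ) (z : ℂ) : f z = f 0 + z * dslope f 0 z := by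
  have := sub_smul_dslope f 0 z
  rw [sub_zero, smul_eq_mul] at this
  rw [this]
  ring

/-- A second order Schwarz–Pick inequality for the coefficients of a bounded function. -/
theorem norm_second_coeff_le {G : ℂ → ℂ} (hG : DifferentiableOn ℂ G (ball 0 1))
    (hm : MapsTo G (ball 0 1) (closedBall 0 1)) {s : ℝ} (hs : s ∈ Ioo (0 : ℝ) 1) (h0 : G 0 = s) :
    ‖(1 - (s : ℂ) ^ 2) * deriv (dslope G 0) 0 + s * deriv G 0 ^ 2‖ ≤
      (1 - s ^ 2) ^ 2 - ‖deriv G 0‖ ^ 2 := by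
  have hz0 : (0 : ℂ) ∈ ball (0 : ℂ) 1 := by simp
  have hn : ball (0 : ℂ) 1 ∈ 𝓝 0 := isOpen_ball.mem_nhds hz0
  have hle : ∀ z ∈ ball (0 : ℂ) 1, ‖G z‖ ≤ 1 := fun z hz => by simpa using hm hz
  have hne : ∀ z ∈ ball (0 : ℂ) 1, 1 - s * G z ≠ 0 := by
    intro z hz h
    have h1 : ‖s * G z‖ < 1 := by
      rw [norm_mul, Complex.norm_of_nonneg hs.1.le]
      nlinarith [hle z hz, hs.1, hs.2]
    rw [← sub_eq_zero.1 h] at h1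
    simp at h1
  have hden : DifferentiableOn ℂ (fun z => 1 - s * G z) (ball 0 1) :=
    (hG.const_mul _).const_sub _
  have hG1 : DifferentiableOn ℂ (dslope G 0) (ball 0 1) :=
    (Complex.differentiableOn_dslope hn).2 hG
  set M : ℂ → ℂ := fun z => (G z - s) / (1 - s * G z) with hM
  set N : ℂ → ℂ := fun z => dslope G 0 z / (1 - s * G z) with hN
  have hMd : DifferentiableOn ℂ M (ball 0 1) := (hG.sub_const _).div hden hne
  have hNd : DifferentiableOn ℂ N (ball 0 1) := hG1.div hden hne
  have hM0 : M 0 = 0 := by simp [hM, h0]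
  have hMm : MapsTo M (ball 0 1) (closedBall (M 0) 1) := by
    intro z hz
    rw [hM0, mem_closedBall_zero_iff, hM]
    simp only [norm_div]
    rw [div_le_one (norm_pos_iff.2 (hne z hz)), ← sq_le_sq₀ (norm_nonneg _) (norm_nonneg _)]
    have h1 : ‖G z‖ ^ 2 ≤ 1 := pow_le_one₀ (norm_nonneg _) (hle z hz)
    have h2 : s ^ 2 ≤ 1 := pow_le_one₀ hs.1.le hs.2.le
    rw [← Complex.normSq_eq_norm_sq, Complex.normSq_apply] at h1 ⊢
    rw [← Complex.normSq_eq_norm_sq, Complex.normSq_apply]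
    simp only [Complex.sub_re, Complex.sub_im, Complex.mul_re, Complex.mul_im, Complex.one_re,
      Complex.one_im, Complex.ofReal_re, Complex.ofReal_im]
    nlinarith [mul_nonneg (sub_nonneg.2 h1) (sub_nonneg.2 h2)]
  -- `N` is the Schwarz quotient `M(z)/z`, hence bounded by `1`; Schwarz–Pick for `N` is the desired
  -- inequality.
  have hNM : EqOn N (dslope M 0) (ball 0 1) := by
    refine eqOn_ball_of_eq_of_ne hNd ((Complex.differentiableOn_dslope hn).2 hMd)
      fun z hz hz' => mul_left_cancel₀ hz' ?_
    have h1 := eq_add_mul_dslope_zero M z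
    have h2 := eq_add_mul_dslope_zero G z
    rw [hM0, zero_add] at h1
    rw [← h1, hN, hM]
    simp only
    rw [← mul_div_assoc, h2, h0, add_sub_cancel_left, ← h0, ← h2]
  have hNm : MapsTo N (ball 0 1) (closedBall 0 1) := fun z hz => by
    rw [hNM hz, mem_closedBall_zero_iff]
    simpa using Complex.norm_dslope_le_div_of_mapsTo_ball hMd hMm hz
  have hSP := norm_deriv_zero_le_one_sub_sq hNd hNm
  have hc : 0 < 1 - s ^ 2 := by nlinarith [hs.1, hs.2]
  have hcc : (1 : ℂ) - (s : ℂ) ^ 2 = ((1 - s ^ 2 : ℝ) : ℂ) := by push_cast; rfl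
  have hcC : (1 : ℂ) - (s : ℂ) ^ 2 ≠ 0 := by
    rw [hcc]
    exact_mod_cast hc.ne'
  have hN' : deriv N 0 = ((1 - (s : ℂ) ^ 2) * deriv (dslope G 0) 0 + s * deriv G 0 ^ 2) /
      (1 - (s : ℂ) ^ 2) ^ 2 := by
    refine ((hG1.differentiableAt hn).hasDerivAt.div
      (((hG.differentiableAt hn).hasDerivAt.const_mul (s : ℂ)).const_sub 1)
      (hne 0 hz0)).deriv.trans ?_
    rw [h0, dslope_same]
    congr 1 <;> ring
  have hN0 : N 0 = deriv G 0 / (1 - (s : ℂ) ^ 2) := by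
    simp only [hN, h0, dslope_same]
    rw [sq]
  rw [hN', hN0, norm_div, norm_div, norm_pow, hcc, Complex.norm_of_nonneg hc.le,
    div_le_iff₀ (by positivity), ← hcc] at hSP
  refine hSP.trans_eq ?_
  field_simp

/-- The coefficient inequality obtained by comparing a starlike function `φ z = z + z² Q z` with
its multiple `s φ`. -/
theorem norm_coeff_le_of_starlike {φ Q : ℂ → ℂ} (hφ : φ ∈ classStarlike)
    (hQ : DifferentiableOn ℂ Q (ball 0 1)) (hφQ : ∀ z ∈ ball (0 : ℂ) 1, φ z = z + z ^ 2 * Q z)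
    {s : ℝ} (hs : s ∈ Ioo (0 : ℝ) 1) :
    ‖(1 + (s : ℂ)) ^ 2 * s * deriv Q 0 - 2 * (1 + s) * s ^ 2 * Q 0 ^ 2 + s ^ 3 * Q 0 ^ 2‖ ≤
      (1 + s) ^ 2 - s ^ 2 * ‖Q 0‖ ^ 2 := by
  obtain ⟨⟨⟨han, hφ0, -⟩, hinj⟩, hstar⟩ := hφ
  have hz0 : (0 : ℂ) ∈ ball (0 : ℂ) 1 := by simp
  have hn : ball (0 : ℂ) 1 ∈ 𝓝 0 := isOpen_ball.mem_nhds hz0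
  set ψ := Function.invFunOn φ (ball 0 1)
  have hψ : ∀ z ∈ ball (0 : ℂ) 1, ψ (φ z) = z := hinj.leftInvOn_invFunOn
  have hmem : ∀ z ∈ ball (0 : ℂ) 1, (s : ℂ) * φ z ∈ φ '' ball 0 1 := fun z hz => by
    simpa using hstar.smul_mem (mem_image_of_mem φ hz) hs.1.le hs.2.le
  set g : ℂ → ℂ := fun z => ψ (s * φ z) with hg
  have hgb : ∀ z ∈ ball (0 : ℂ) 1, g z ∈ ball (0 : ℂ) 1 := fun z hz =>
    Function.invFunOn_mem (hmem z hz)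
  have hφg : ∀ z ∈ ball (0 : ℂ) 1, φ (g z) = s * φ z := fun z hz =>
    Function.invFunOn_eq (hmem z hz)
  have hgd : DifferentiableOn ℂ g (ball 0 1) := by
    intro z hz
    obtain ⟨w, hw, hwz⟩ := hmem z hz
    have h1 : DifferentiableAt ℂ ψ (s * φ z) :=
      hwz ▸ differentiableAt_of_leftInverse_of_analyticOnNhd isOpen_ball han hψ hw
    exact (h1.comp z ((han z hz).differentiableAt.const_mul (s : ℂ))).differentiableWithinAt
  have hg0 : g 0 = 0 := by
    have := hψ 0 hz0
    rw [hφ0] at this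
    simp [hg, hφ0, this]
  set G := dslope g 0 with hGdef
  have hgG : ∀ z, g z = z * G z := fun z => by
    rw [eq_add_mul_dslope_zero g z, hg0, zero_add]
  have hGd : DifferentiableOn ℂ G (ball 0 1) := (Complex.differentiableOn_dslope hn).2 hgd
  have hG1 : DifferentiableOn ℂ (dslope G 0) (ball 0 1) :=
    (Complex.differentiableOn_dslope hn).2 hGd
  have hGm : MapsTo G (ball 0 1) (closedBall 0 1) := fun z hz => by
    rw [mem_closedBall_zero_iff]
    simpa using Complex.norm_dslope_le_div_of_mapsTo_ball (R₂ := 1) hgd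
      (fun z hz => ball_subset_closedBall (by rw [hg0]; exact hgb z hz)) hz
  have hQg : DifferentiableOn ℂ (fun z => Q (g z)) (ball 0 1) := hQ.comp hgd hgb
  have hid : DifferentiableOn ℂ (fun z : ℂ => z) (ball 0 1) := differentiableOn_id
  have hrel : ∀ z ∈ ball (0 : ℂ) 1, g z + g z ^ 2 * Q (g z) = s * (z + z ^ 2 * Q z) :=
    fun z hz => by rw [← hφQ _ (hgb z hz), ← hφQ z hz, hφg z hz]
  -- The equation `φ ∘ g = sφ` divided by `z`; subtracting the value at `0` and dividing again gives
  -- `h2`, from which the coefficients of `G` are read off.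
  have h1 : EqOn (fun z => G z + z * G z ^ 2 * Q (g z)) (fun z => s * (1 + z * Q z))
      (ball 0 1) := by
    refine eqOn_ball_of_eq_of_ne (hGd.add ((hid.mul (hGd.pow 2)).mul hQg))
      (((hid.mul hQ).const_add 1).const_mul _) fun z hz hz' => mul_left_cancel₀ hz' ?_
    have := hrel z hz
    rw [show g z ^ 2 = (z * G z) ^ 2 by rw [hgG]] at this
    linear_combination this - hgG z
  have hG0 : G 0 = s := by simpa using h1 hz0
  have h2 : EqOn (fun z => dslope G 0 z + G z ^ 2 * Q (g z)) (fun z => s * Q z)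
      (ball 0 1) := by
    refine eqOn_ball_of_eq_of_ne (hG1.add ((hGd.pow 2).mul hQg)) (hQ.const_mul _)
      fun z hz hz' => mul_left_cancel₀ hz' ?_
    have h3 := h1 hz
    have h4 := eq_add_mul_dslope_zero G z
    rw [hG0] at h4
    simp only at h3 ⊢
    linear_combination h3 - h4
  have ha : deriv G 0 = s * (1 - s) * Q 0 := by
    have := h2 hz0
    simp only [dslope_same, hG0, hg0] at this
    linear_combination this
  have hgder : HasDerivAt g s 0 := by
    have := (hgd.differentiableAt hn).hasDerivAt
    rwa [← dslope_same, ← hGdef, hG0] at this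
  have hb : deriv (dslope G 0) 0 = s * deriv Q 0 - (2 * s * deriv G 0 * Q 0 +
      s ^ 2 * (deriv Q 0 * s)) := by
    have hQ0 : HasDerivAt Q (deriv Q 0) (g 0) := by
      rw [hg0]
      exact (hQ.differentiableAt hn).hasDerivAt
    have hl := (hG1.differentiableAt hn).hasDerivAt.add
      (((hGd.differentiableAt hn).hasDerivAt.pow 2).mul (hQ0.comp 0 hgder))
    have hr := (hQ.differentiableAt hn).hasDerivAt.const_mul (s : ℂ)
    have := hl.unique (hr.congr_of_eventuallyEq (h2.eventuallyEq_of_mem hn))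
    simp [hG0, hg0] at this
    linear_combination this
  have key := norm_second_coeff_le hGd hGm hs hG0
  have hpos : 0 < 1 - s := by linarith [hs.2]
  have e1 : (1 - (s : ℂ) ^ 2) * deriv (dslope G 0) 0 + s * deriv G 0 ^ 2 =
      (((1 - s) ^ 2 : ℝ) : ℂ) * ((1 + (s : ℂ)) ^ 2 * s * deriv Q 0 -
        2 * (1 + s) * s ^ 2 * Q 0 ^ 2 + s ^ 3 * Q 0 ^ 2) := by
    rw [hb, ha]
    push_cast
    ring
  have e2 : ‖deriv G 0‖ = s * (1 - s) * ‖Q 0‖ := by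
    rw [ha, norm_mul, norm_mul, Complex.norm_of_nonneg hs.1.le,
      show (1 : ℂ) - s = ((1 - s : ℝ) : ℂ) by push_cast; rfl, Complex.norm_of_nonneg hpos.le]
  rw [e1, e2, norm_mul, Complex.norm_of_nonneg (by positivity)] at key
  refine le_of_mul_le_mul_left (key.trans_eq ?_) (show 0 < (1 - s) ^ 2 by positivity)
  ring

/-- The limit `s → 1` of the comparison of `φ` with `sφ`. -/
theorem norm_four_mul_sub_le_of_starlike {φ Q : ℂ → ℂ} (hφ : φ ∈ classStarlike)
    (hQ : DifferentiableOn ℂ Q (ball 0 1)) (hφQ : ∀ z ∈ ball (0 : ℂ) 1, φ z = z + z ^ 2 * Q z) :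
    ‖4 * deriv Q 0 - 3 * Q 0 ^ 2‖ ≤ 4 - ‖Q 0‖ ^ 2 := by
  have hl : Tendsto (fun s : ℝ => ‖(1 + (s : ℂ)) ^ 2 * s * deriv Q 0 -
      2 * (1 + s) * s ^ 2 * Q 0 ^ 2 + s ^ 3 * Q 0 ^ 2‖) (𝓝[<] 1) _ :=
    (Continuous.tendsto (by fun_prop) 1).mono_left nhdsWithin_le_nhds
  have hr : Tendsto (fun s : ℝ => (1 + s) ^ 2 - s ^ 2 * ‖Q 0‖ ^ 2) (𝓝[<] 1) _ :=
    (Continuous.tendsto (by fun_prop) 1).mono_left nhdsWithin_le_nhds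
  have := le_of_tendsto_of_tendsto hl hr (by
    filter_upwards [Ioo_mem_nhdsLT (zero_lt_one' ℝ)] with s hs
      using norm_coeff_le_of_starlike hφ hQ hφQ hs)
  rw [Complex.ofReal_one] at this
  calc ‖4 * deriv Q 0 - 3 * Q 0 ^ 2‖ = _ := congrArg norm (by ring)
    _ ≤ _ := this
    _ = 4 - ‖Q 0‖ ^ 2 := by ring

/-! ### From the power series to the theorem -/

/-- The quotient of a power series by `z²` is analytic, with the expected first coefficients. -/
theorem exists_eq_add_sq_mul_of_hasSum {φ : ℂ → ℂ} (hφ : DifferentiableOn ℂ φ (ball 0 1))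
    {c : ℕ → ℂ}
    (hc : ∀ z ∈ ball (0 : ℂ) 1, HasSum (fun n : ℕ => c (n + 2) * z ^ (n + 2)) (φ z - z)) :
    ∃ Q : ℂ → ℂ, DifferentiableOn ℂ Q (ball 0 1) ∧ Q 0 = c 2 ∧ deriv Q 0 = c 3 ∧
      ∀ z ∈ ball (0 : ℂ) 1, φ z = z + z ^ 2 * Q z := by
  set Q : ℂ → ℂ := fun z => if z = 0 then c 2 else (φ z - z) / z ^ 2 with hQ
  have hz0 : (0 : ℂ) ∈ ball (0 : ℂ) 1 := by simp
  have hn : ball (0 : ℂ) 1 ∈ 𝓝 0 := isOpen_ball.mem_nhds hz0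
  have hφ0 : φ 0 = 0 := by
    have := (hc 0 hz0).tsum_eq
    simpa [eq_comm] using this
  have hQ0 : Q 0 = c 2 := if_pos rfl
  have hQne : ∀ z, z ≠ 0 → Q z = (φ z - z) / z ^ 2 := fun z hz => if_neg hz
  have hp : HasFPowerSeriesAt Q (FormalMultilinearSeries.ofScalars ℂ fun n => c (n + 2)) 0 := by
    rw [hasFPowerSeriesAt_iff]
    filter_upwards [hn] with z hz
    simp only [FormalMultilinearSeries.coeff_ofScalars, zero_add, smul_eq_mul]
    rcases eq_or_ne z 0 with rfl | hne
    · rw [hQ0]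
      simpa using hasSum_single (f := fun n : ℕ => (0 : ℂ) ^ n * c (n + 2)) 0
        fun n hn => by simp [hn]
    · rw [hQne z hne]
      have hfun : (fun n : ℕ => z ^ n * c (n + 2)) =
          fun n => c (n + 2) * z ^ (n + 2) / z ^ 2 := by
        funext n
        rw [pow_add]
        field_simp
      rw [hfun]
      exact (hc z hz).div_const (z ^ 2)
  refine ⟨Q, ?_, hQ0, ?_, fun z _ => ?_⟩
  · intro z hz
    rcases eq_or_ne z 0 with rfl | hne
    · exact hp.analyticAt.differentiableAt.differentiableWithinAt
    · have h1 : DifferentiableAt ℂ (fun z => (φ z - z) / z ^ 2) z :=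
        ((hφ.differentiableAt (isOpen_ball.mem_nhds hz)).sub differentiableAt_id).div
          (by fun_prop) (pow_ne_zero 2 hne)
      refine (h1.congr_of_eventuallyEq ?_).differentiableWithinAt
      filter_upwards [isOpen_ne.mem_nhds hne] with w hw using hQne w hw
  · rw [hp.deriv]
    simp
  · rcases eq_or_ne z 0 with rfl | hne
    · simp [hφ0]
    · rw [hQne z hne]
      field_simp
      ring

theorem mainTheorem12 (α : ℝ) (hα : α ∈ Set.Ioc (1 : ℝ) 2)
    (φ : ℂ → ℂ) (hφ : φ ∈ classStarlike) (c : ℕ → ℂ)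
    (hc : ∀ z ∈ Metric.ball (0 : ℂ) 1,
      HasSum (fun n : ℕ => c (n + 2) * z ^ (n + 2)) (φ z - z)) :
    coeffA (c 3) (c 2) α ∈ closure (hFun α '' Metric.ball (0 : ℂ) 1) := by
  obtain ⟨Q, hQ, hQ0, hQ1, hφQ⟩ :=
    exists_eq_add_sq_mul_of_hasSum hφ.1.1.1.differentiableOn hc
  have key := norm_four_mul_sub_le_of_starlike hφ hQ hφQ
  rw [hQ0, hQ1] at key
  have hn : ‖-(c 2 / 2)‖ = ‖c 2‖ / 2 := by simp
  have hd : ‖c 3 - 3 / 4 * c 2 ^ 2‖ ≤ 1 - ‖-(c 2 / 2)‖ ^ 2 := by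
    have : 4 * c 3 - 3 * c 2 ^ 2 = 4 * (c 3 - 3 / 4 * c 2 ^ 2) := by ring
    rw [this, norm_mul, Complex.norm_ofNat] at key
    rw [hn]
    linarith
  -- The classical `|φ₂| ≤ 2` is a by-product: the right side of `hd` must be nonnegative.
  have hw : ‖-(c 2 / 2)‖ ≤ 1 := by
    nlinarith [norm_nonneg (-(c 2 / 2)), norm_nonneg (c 3 - 3 / 4 * c 2 ^ 2)]
  convert mem_closure_image_hFun hα hw hd using 1
  have hα' : (α : ℂ) + 1 ≠ 0 := by
    have : α + 1 ≠ 0 := by linarith [hα.1]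
    exact_mod_cast this
  rw [coeffA, hFun]
  field_simp
  ring
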